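/- Let $G$ be a Garside group with a Garside structure $(G,P,\Delta)$ of finite type. That is, $G$ carries a left-invariant lattice order $\preceq$ with meet $\wedge$ and positive cone $P=\{x : 1\preceq x\}$; $\Delta\in P$ is such that the set of simple elements $[1,\Delta]=\{s:1\preceq s\preceq\Delta\}$ is finite and generates $G$, and $\Delta^{-1}P\Delta=P$; and $P$ is atomic: for every $x\in P$ the length of the strict chains $1\prec x_1\prec\cdots\prec x_r=x$ is bounded. Every $X\in G$ (with $G\ne 1$) has a unique left normal form $X=\Delta^p x_1\cdots x_r$, where $p$ is the maximal integer with $\Delta^p\preceq X$, and $1\neq x_i=(x_i\cdots x_r)\wedge\Delta$ for all $i$. Put $\inf(X)=p$, $\sup(X)=p+r$, $\ell(X)=r$; for trivial $G$ put $\inf=\sup=\ell=0$. Let $\tau(x)=\Delta^{-1}x\Delta$. The initial factor of $X$ is $\iota(X)=\tau^{-p}(x_1)$ if $r>0$ and $\iota(X)=1$ if $r=0$, and the cycling of $X$ is $\mathbf c(X)=\iota(X)^{-1}X\,\iota(X)$. The super summit set $SSS(X)$ is the set of conjugates of $X$ of minimal canonical length $\ell$, and the ultra summit set is $USS(X)=\{Y\in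 SSS(X) : \mathbf c^t(Y)=Y \text{ for some } t>0\}$. For $i\ge 1$ let $C_i=\iota(\mathbf c^{i-1}(X))$, and for $m\ge1$ let $\mathbf C_m=C_1C_2\cdots C_m$. **Theorem.** Let $X\in USS(X)$, $p=\inf(X)$ and $m\ge 1$. 1. If $\ell(X)>1$, then $\inf(X^m\Delta^{-mp})\ge 0$, $\sup(X^m\Delta^{-mp})\ge m$, and the product of the first $m$ factors (including the factors $\Delta$) in the left normal form of $X^m\Delta^{-mp}$ is equal to $\mathbf C_m$; that is, $$(X^m\Delta^{-mp})\wedge\Delta^m=\mathbf C_m .$$ In particular, $\iota(X^m)=\iota(\mathbf C_m)$. 2. For every value of $\ell(X)$, $\inf(X^m)=m\inf(X)+\inf(\mathbf C_m)$. -/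

import Mathlib

namespace GarsideGroup

section

variable {G : Type*} [Group G] [Lattice G]

/-- `G` is a group with a lattice order `≤` (the prefix order; left invariance is the class
`MulLeftMono G`), whose positive cone is `P = {x | 1 ≤ x}`. This says that `(G, P, Δ)` is a
Garside structure of finite type. -/
structure IsGarside (Δ : G) : Prop where
  one_le : 1 ≤ Δ
  /-- there are finitely many simple elements -/
  finite_simple : (Set.Icc 1 Δ).Finite
  /-- the simple elements generate `G` -/
  closure_simple : Subgroup.closure (Set.Icc 1 Δ) = ⊤
  /-- conjugation by `Δ` maps the positive cone onto itself -/
  conj_positive : ∀ x : G, 1 ≤ Δ⁻¹ * x * Δ ↔ 1 ≤ x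
  /-- the positive cone is atomic: the number of factors in a decomposition of a positive element
  into nontrivial positive factors (that is, the length of a strict chain from `1` to it) is
  bounded -/
  atomic : ∀ x : G, 1 ≤ x →
    ∃ N : ℕ, ∀ l : List G, (∀ a ∈ l, 1 < a) → l.prod = x → l.length ≤ N

/-- The shift map `τ(x) = Δ⁻¹ x Δ`. -/
def shift (Δ : G) : MulAut G := MulAut.conj Δ⁻¹

/-- `X = Δ ^ p * x₁ ⋯ x_r` is the left normal form of `X`, where `xs = [x₁, …, x_r]`. -/
structure IsLeftNormalForm (Δ X : G) (p : ℤ) (xs : List G) : Prop where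
  eq_mul_prod : X = Δ ^ p * xs.prod
  isGreatest : IsGreatest {k : ℤ | Δ ^ k ≤ X} p
  ne_one : ∀ x ∈ xs, x ≠ 1
  /-- `x_i` is the biggest simple prefix of `x_i ⋯ x_r` -/
  factor : ∀ (i : ℕ) (hi : i < xs.length), xs[i] = (xs.drop i).prod ⊓ Δ

open Classical in
/-- The left normal form of `X`, as the exponent of `Δ` together with the list of the other
factors (it exists and is unique in a nontrivial Garside group). -/
noncomputable def leftNormalForm (Δ X : G) : ℤ × List G :=
  if h : ∃ q : ℤ × List G, IsLeftNormalForm Δ X q.1 q.2 then h.choose else (0, [])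

/-- `inf(X) = p` if `Δ ^ p * x₁ ⋯ x_r` is the left normal form of `X`. -/
noncomputable def infimum (Δ X : G) : ℤ := (leftNormalForm Δ X).1

/-- `ℓ(X) = r` if `Δ ^ p * x₁ ⋯ x_r` is the left normal form of `X`. -/
noncomputable def canonicalLength (Δ X : G) : ℕ := (leftNormalForm Δ X).2.length

/-- `sup(X) = p + r` if `Δ ^ p * x₁ ⋯ x_r` is the left normal form of `X`. -/
noncomputable def supremum (Δ X : G) : ℤ := infimum Δ X + canonicalLength Δ X

/-- The product of the first `m` factors, including the factors `Δ`, in the left normal form of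
`X` (meaningful if `0 ≤ inf(X)` and `m ≤ sup(X)`). -/
noncomputable def firstFactorsProd (Δ X : G) (m : ℕ) : G :=
  ((List.replicate (infimum Δ X).toNat Δ ++ (leftNormalForm Δ X).2).take m).prod

/-- The initial factor: `ι(X) = τ^{-p}(x₁)` if `Δ ^ p * x₁ ⋯ x_r`, `r > 0`, is the left normal
form of `X`, and `ι(Δ ^ p) = 1`. -/
noncomputable def initialFactor (Δ X : G) : G :=
  match (leftNormalForm Δ X).2 with
  | [] => 1
  | x :: _ => (shift Δ ^ (-infimum Δ X)) x

/-- The cycling `c(X) = ι(X)⁻¹ X ι(X)`. -/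
noncomputable def cycling (Δ X : G) : G :=
  (initialFactor Δ X)⁻¹ * X * initialFactor Δ X

/-- The super summit set: the conjugates of `X` of minimal canonical length. -/
def superSummitSet (Δ X : G) : Set G :=
  {Y | IsConj X Y ∧ ∀ Z, IsConj X Z → canonicalLength Δ Y ≤ canonicalLength Δ Z}

/-- The ultra summit set: the elements of the super summit set which are periodic under
cycling. -/
def ultraSummitSet (Δ X : G) : Set G :=
  {Y | Y ∈ superSummitSet Δ X ∧ ∃ t : ℕ, 0 < t ∧ (cycling Δ)^[t] Y = Y}

/-- The conjugators `C_i = ι(c^{i-1}(X))`, for `i ≥ 1`. -/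
noncomputable def cyclingConjugator (Δ X : G) (i : ℕ) : G :=
  initialFactor Δ ((cycling Δ)^[i - 1] X)

/-- `C_1 C_2 ⋯ C_m`. -/
noncomputable def cyclingConjugatorProd (Δ X : G) (m : ℕ) : G :=
  ((List.range m).map fun i => cyclingConjugator Δ X (i + 1)).prod

end

end GarsideGroup

namespace GarsideGroup

/-! ### Iterates of meet-preserving maps -/

section Semilattice

variable {α : Type*} [SemilatticeInf α]

/-! Put `ψ s = X s Δ^(-p)`, `δ s = s Δ` and `F = ψ ⊓ δ`. Since `inf` is constant on a cycling orbit
of period `t`, the definition of cycling gives `C_m = F^m(1)`, while `ψ^m(1) = X^m Δ^(-mp)` and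
`δ^m(1) = Δ^m`. The heart is therefore `F^m(1) = ψ^m(1) ⊓ δ^m(1)`
(`iterate_eq_iterate_inf_iterate`). Expanding `F^m` naively gives the meet of all mixed terms `ψ^i
δ^(m-i)(1)`; periodicity makes the two extreme terms suffice.

Indeed `C_t` commutes with `X`, so left multiplication `c` by `C_t` commutes with `ψ` and `δ`, and
`F^t(1) = c(1)`. Where `F^t = c`, the map `F` has inverse `K = c⁻¹ F^(t-1)`, so `ψK ⊓ δK = id`
there. This identity passes to powers (`iterate_inf_iterate_eq_self`); evaluating it at `F^m(1)`
gives the claim. The statements on `inf`, `sup` and `ι` follow by comparing `C_m` with `C_(m-1)`. -/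

theorem iterate_inf_le_of_inf_eq_self {S : Set α} {x y : α → α} (hx : Monotone x)
    (hinf : ∀ a b, x (a ⊓ b) = x a ⊓ x b)
    (hyS : Set.MapsTo y S S) (h : ∀ s ∈ S, x s ⊓ y s = s) (n : ℕ) {s : α} (hs : s ∈ S) :
    x^[n] s ⊓ y s ≤ s := by
  induction n with
  | zero => exact inf_le_left
  | succ n ih =>
    -- As `y s` stays in `S`, it lies below its image under `x`; so applying `x` to the induction
    -- hypothesis only enlarges the `y s` term.
    have hle : y s ≤ x (y s) := by
      conv_lhs => rw [← h (y s) (hyS hs)]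
      exact inf_le_left
    have h1 : x^[n + 1] s ⊓ y s ≤ x s := by
      refine le_trans ?_ (hx ih)
      rw [hinf, Function.iterate_succ_apply']
      exact inf_le_inf_left _ hle
    calc x^[n + 1] s ⊓ y s ≤ x s ⊓ y s := le_inf h1 inf_le_right
      _ = s := h s hs

/-- If commuting maps `x`, `y` satisfy `x ⊓ y = id` on an invariant set, so do their powers. -/
theorem iterate_inf_iterate_eq_self {S : Set α} {x y : α → α}
    (hx : ∀ a b, x (a ⊓ b) = x a ⊓ x b) (hy : ∀ a b, y (a ⊓ b) = y a ⊓ y b)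
    (hxS : Set.MapsTo x S S) (hyS : Set.MapsTo y S S)
    (h : ∀ s ∈ S, x s ⊓ y s = s) (n : ℕ) {s : α} (hs : s ∈ S) :
    x^[n] s ⊓ y^[n] s = s := by
  have mono : ∀ {f : α → α}, (∀ a b, f (a ⊓ b) = f a ⊓ f b) → Monotone f := by
    intro f hf a b hab
    rw [← inf_eq_left, ← hf, inf_eq_left.2 hab]
  have le_self : ∀ {f : α → α}, Set.MapsTo f S S → (∀ s ∈ S, s ≤ f s) →
      ∀ n : ℕ, ∀ s ∈ S, s ≤ f^[n] s := by
    intro f hfS hf n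
    induction n with
    | zero => exact fun s _ => le_rfl
    | succ n ih => exact fun s hs => (hf s hs).trans (ih _ (hfS hs))
  have hxle : ∀ s ∈ S, s ≤ x s := fun s hs => by
    conv_lhs => rw [← h s hs]
    exact inf_le_left
  have hyle : ∀ s ∈ S, s ≤ y s := fun s hs => by
    conv_lhs => rw [← h s hs]
    exact inf_le_right
  -- First only `x` is raised to a power; the same lemma is then applied with `y` and `x^[n]` in the
  -- roles of `x` and `y`.
  have h' : ∀ s ∈ S, y s ⊓ x^[n] s = s := fun s hs => by
    rw [inf_comm]
    exact le_antisymm (iterate_inf_le_of_inf_eq_self (mono hx) hx hyS h n hs)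
      (le_inf (le_self hxS hxle n s hs) (hyle s hs))
  refine le_antisymm ?_ (le_inf (le_self hxS hxle n s hs) (le_self hyS hyle n s hs))
  rw [inf_comm]
  exact iterate_inf_le_of_inf_eq_self (mono hy) hy (hxS.iterate n) h' n hs

/-- If `F = ψ ⊓ δ` for commuting `ψ`, `δ` and `a` is periodic under `F` up to a symmetry `c`, then
the powers of `F` at `a` are the meets of the powers of `ψ` and `δ`. -/
theorem iterate_eq_iterate_inf_iterate {ψ δ F : α → α} {c : α ≃o α}
    (hψ : ∀ a b, ψ (a ⊓ b) = ψ a ⊓ ψ b) (hδ : ∀ a b, δ (a ⊓ b) = δ a ⊓ δ b)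
    (hF : ∀ s, F s = ψ s ⊓ δ s) (hψδ : Function.Commute ψ δ) (hψc : Function.Commute ψ c)
    (hδc : Function.Commute δ c) {a : α} {t : ℕ} (ht : 0 < t) (ha : F^[t] a = c a) (m : ℕ) :
    F^[m] a = ψ^[m] a ⊓ δ^[m] a := by
  obtain ⟨t, rfl⟩ := Nat.exists_eq_succ_of_ne_zero ht.ne'
  have symm_comm : ∀ {f : α → α}, Function.Commute f c → Function.Commute f c.symm := by
    intro f hf s
    rw [OrderIso.eq_symm_apply, ← hf, OrderIso.apply_symm_apply]
  have hFinf : ∀ a b, F (a ⊓ b) = F a ⊓ F b := fun a b => by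
    rw [hF, hF, hF, hψ, hδ, inf_inf_inf_comm]
  have hFψ : Function.Commute F ψ := fun s => by rw [hF, hF, hψ, hψδ s]
  have hFδ : Function.Commute F δ := fun s => by rw [hF, hF, hδ, hψδ s]
  have hFc : Function.Commute F c := fun s => by rw [hF, hF, c.map_inf, hψc s, hδc s]
  have hiter : ∀ n : ℕ, ∀ a b, F^[n] (a ⊓ b) = F^[n] a ⊓ F^[n] b := by
    intro n
    induction n with
    | zero => exact fun _ _ => rfl
    | succ n ih => exact fun a b => by simp only [Function.iterate_succ_apply, hFinf, ih]
  -- The inverse of `F` on the set `S` below; the period is now `t + 1`.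
  set K : α → α := c.symm ∘ F^[t] with hK
  have hKinf : ∀ a b, K (a ⊓ b) = K a ⊓ K b := fun a b => by
    simp only [hK, Function.comp_apply, hiter, OrderIso.map_inf]
  have hψK : Function.Commute ψ K := (symm_comm hψc).comp_right (hFψ.symm.iterate_right t)
  have hδK : Function.Commute δ K := (symm_comm hδc).comp_right (hFδ.symm.iterate_right t)
  have hFK : Function.Commute F K :=
    (symm_comm hFc).comp_right ((Function.Commute.refl F).iterate_right t)
  have hcK : Function.Commute (⇑c) K :=
    (symm_comm (Function.Commute.refl (⇑c))).comp_right (hFc.symm.iterate_right t)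
  let S : Set α := {s | F^[t + 1] s = c s}
  have hmaps : ∀ {f : α → α}, Function.Commute F f → Function.Commute f c → Set.MapsTo f S S := by
    intro f hf hfc s hs
    change F^[t + 1] (f s) = c (f s)
    rw [(hf.iterate_left (t + 1)) s, ← hfc s]
    exact congrArg f hs
  have hKF : ∀ s ∈ S, K (F s) = s := fun s hs => by
    change c.symm (F^[t] (F s)) = s
    rw [← Function.iterate_succ_apply, OrderIso.symm_apply_eq]
    exact hs
  have hKS : Set.MapsTo K S S := hmaps hFK hcK.symm
  have h := iterate_inf_iterate_eq_self (S := S) (x := ψ ∘ K) (y := δ ∘ K)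
    (fun a b => by simp only [Function.comp_apply, hKinf, hψ])
    (fun a b => by simp only [Function.comp_apply, hKinf, hδ])
    ((hmaps hFψ hψc).comp hKS) ((hmaps hFδ hδc).comp hKS)
    (fun s hs => by
      rw [Function.comp_apply, Function.comp_apply, ← hF, hFK s, hKF s hs]) m
    ((hmaps (Function.Commute.refl F) hFc).iterate m ha)
  -- The identity `h` is taken at `F^[m] a`, so that the powers of `K` in it cancel.
  have hfix : K^[m] (F^[m] a) = a := by
    have := Function.iterate_fixed (f := K ∘ F) (hKF a ha) m
    rwa [hFK.symm.comp_iterate] at this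
  rwa [hψK.comp_iterate, hδK.comp_iterate, Function.comp_apply, Function.comp_apply, hfix,
    eq_comm] at h

end Semilattice

/-! ### Greedy lists and cycling conjugators: algebraic preliminaries -/

theorem iterate_mul_mul_zpow {G : Type*} [Group G] (Δ X : G) (p : ℤ) (m : ℕ) (s : G) :
    (fun s => X * s * Δ ^ (-p))^[m] s = X ^ m * s * Δ ^ (-(m * p)) := by
  induction m with
  | zero => simp
  | succ m ih =>
    rw [Function.iterate_succ_apply', ih, pow_succ', Nat.cast_succ, add_mul, one_mul, neg_add,
      zpow_add]
    simp only [mul_assoc]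

variable {G : Type*} [Group G] [Lattice G] {Δ : G}

theorem IsGarside.one_lt [Nontrivial G] (hΔ : IsGarside Δ) : 1 < Δ := by
  refine lt_of_le_of_ne hΔ.one_le ?_
  rintro rfl
  have h := hΔ.closure_simple
  rw [Set.Icc_self, Subgroup.closure_singleton_one] at h
  exact bot_ne_top h

/-- Every entry of the list is the biggest simple prefix of the product from there on. -/
def IsGreedy (Δ : G) : List G → Prop
  | [] => True
  | x :: l => x = x * l.prod ⊓ Δ ∧ IsGreedy Δ l

theorem isGreedy_iff {l : List G} :
    IsGreedy Δ l ↔ ∀ (i : ℕ) (hi : i < l.length), l[i] = (l.drop i).prod ⊓ Δ := by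
  induction l with
  | nil => simp [IsGreedy]
  | cons x l ih =>
    rw [IsGreedy, ih]
    constructor
    · rintro ⟨h, h'⟩ (_ | i) hi
      · simpa using h
      · simpa using h' i (by simpa using hi)
    · intro h
      exact ⟨h 0 (by simp), fun i hi => h (i + 1) (by simpa using hi)⟩

theorem cyclingConjugatorProd_succ (X : G) (m : ℕ) : cyclingConjugatorProd Δ X (m + 1) =
    cyclingConjugatorProd Δ X m * initialFactor Δ ((cycling Δ)^[m] X) := by
  simp [cyclingConjugatorProd, List.range_succ, cyclingConjugator]

/-- When `m` is a period of cycling, this says that the product of conjugators commutes with `X`. -/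
theorem mul_cyclingConjugatorProd (X : G) (m : ℕ) : X * cyclingConjugatorProd Δ X m =
    cyclingConjugatorProd Δ X m * (cycling Δ)^[m] X := by
  induction m with
  | zero => simp [cyclingConjugatorProd]
  | succ m ih =>
    rw [cyclingConjugatorProd_succ, ← mul_assoc, ih, Function.iterate_succ_apply', cycling]
    group

/-- Every power of `Δ` is a prefix of `X`, so no maximal exponent exists and the default value
applies. -/
theorem leftNormalForm_of_subsingleton [Subsingleton G] (Δ X : G) :
    leftNormalForm Δ X = (0, []) := by
  refine dif_neg ?_
  rintro ⟨q, hq⟩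
  have h : q.1 + 1 ≤ q.1 := hq.isGreatest.2 (Subsingleton.elim (Δ ^ (q.1 + 1)) X).le
  lia

variable [MulLeftMono G]

/-! ### Right multiplication by powers of `Δ` -/

namespace IsGarside

/-- The order is only left-invariant; right multiplication by `Δ` respects it because conjugation by
`Δ` preserves the positive cone. -/
theorem mul_le_mul_right_iff (hΔ : IsGarside Δ) {a b : G} : a * Δ ≤ b * Δ ↔ a ≤ b := by
  have h := hΔ.conj_positive (a⁻¹ * b)
  rw [le_inv_mul_iff_mul_le, mul_one] at h
  rw [← h, mul_assoc, mul_assoc, le_inv_mul_iff_mul_le, mul_one, le_inv_mul_iff_mul_le]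

theorem mul_pow_le_mul_pow_iff (hΔ : IsGarside Δ) (n : ℕ) {a b : G} :
    a * Δ ^ n ≤ b * Δ ^ n ↔ a ≤ b := by
  induction n with
  | zero => simp
  | succ n ih => rw [pow_succ, ← mul_assoc, ← mul_assoc, hΔ.mul_le_mul_right_iff, ih]

theorem mul_zpow_le_mul_zpow_iff (hΔ : IsGarside Δ) (k : ℤ) {a b : G} :
    a * Δ ^ k ≤ b * Δ ^ k ↔ a ≤ b := by
  obtain ⟨n, rfl | rfl⟩ := k.eq_nat_or_neg
  · simpa using hΔ.mul_pow_le_mul_pow_iff n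
  · rw [← hΔ.mul_pow_le_mul_pow_iff n]
    simp

theorem inf_mul_zpow (hΔ : IsGarside Δ) (k : ℤ) (a b : G) :
    (a ⊓ b) * Δ ^ k = a * Δ ^ k ⊓ b * Δ ^ k :=
  OrderIso.map_inf (⟨Equiv.mulRight (Δ ^ k), hΔ.mul_zpow_le_mul_zpow_iff k⟩ : G ≃o G) a b

theorem inf_mul_pow (hΔ : IsGarside Δ) (n : ℕ) (a b : G) :
    (a ⊓ b) * Δ ^ n = a * Δ ^ n ⊓ b * Δ ^ n := by
  simpa using hΔ.inf_mul_zpow n a b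

theorem inf_mul (hΔ : IsGarside Δ) (a b : G) : (a ⊓ b) * Δ = a * Δ ⊓ b * Δ := by
  simpa using hΔ.inf_mul_pow 1 a b

theorem zpow_le_zpow (hΔ : IsGarside Δ) {j k : ℤ} (h : j ≤ k) : Δ ^ j ≤ Δ ^ k := by
  obtain ⟨n, rfl⟩ := Int.le.dest h
  rw [zpow_add, zpow_natCast]
  exact le_mul_of_one_le_right' (one_le_pow_of_one_le' hΔ.one_le n)

theorem zpow_le_zpow_iff [Nontrivial G] (hΔ : IsGarside Δ) {j k : ℤ} :
    Δ ^ j ≤ Δ ^ k ↔ j ≤ k := by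
  refine ⟨fun h => ?_, hΔ.zpow_le_zpow⟩
  by_contra! hlt
  have h1 : Δ ^ (k + 1) ≤ Δ ^ k := (hΔ.zpow_le_zpow hlt).trans h
  rw [zpow_add_one] at h1
  exact absurd ((mul_le_iff_le_one_right' _).1 h1) hΔ.one_lt.not_ge

theorem exists_le_pow (hΔ : IsGarside Δ) (x : G) :
    ∃ n : ℕ, Δ ^ (-(n : ℤ)) ≤ x ∧ x ≤ Δ ^ (n : ℤ) := by
  have hx : x ∈ Subgroup.closure (Set.Icc 1 Δ) := hΔ.closure_simple ▸ Subgroup.mem_top x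
  induction hx using Subgroup.closure_induction with
  | mem x hx =>
    refine ⟨1, le_trans ?_ hx.1, by simpa using hx.2⟩
    simpa using hΔ.zpow_le_zpow (show (-1 : ℤ) ≤ 0 by lia)
  | one => exact ⟨0, by simp⟩
  | mul x y _ _ hx hy =>
    obtain ⟨a, ha, ha'⟩ := hx
    obtain ⟨b, hb, hb'⟩ := hy
    refine ⟨a + b, ?_, ?_⟩
    · rw [Nat.cast_add, neg_add, zpow_add]
      exact ((hΔ.mul_zpow_le_mul_zpow_iff _).2 ha).trans (mul_le_mul_right hb x)
    · rw [Nat.cast_add, zpow_add]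
      exact (mul_le_mul_right hb' x).trans ((hΔ.mul_zpow_le_mul_zpow_iff _).2 ha')
  | inv x _ hx =>
    obtain ⟨n, hn, hn'⟩ := hx
    refine ⟨n, ?_, ?_⟩
    · rw [← hΔ.mul_zpow_le_mul_zpow_iff n, ← mul_le_mul_iff_left x]
      simpa using hn'
    · rw [← hΔ.mul_zpow_le_mul_zpow_iff (-n), ← mul_le_mul_iff_left x]
      simpa using hn

end IsGarside

/-- The exponent descends: `w ≤ w Δ^n ⊓ Δ^(n+1) = (w ⊓ Δ) Δ^n = Δ^n`. -/
theorem le_one_of_inf_eq_one (hΔ : IsGarside Δ) {w : G} (h : w ⊓ Δ = 1) {n : ℕ}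
    (hw : w ≤ Δ ^ n) : w ≤ 1 := by
  induction n with
  | zero => simpa using hw
  | succ n ih =>
    refine ih ?_
    rw [← one_mul (Δ ^ n), ← h, hΔ.inf_mul_pow, ← pow_succ']
    exact le_inf (le_mul_of_one_le_right' (one_le_pow_of_one_le' hΔ.one_le n)) hw

/-! ### Greedy factorizations -/

namespace IsGreedy

theorem one_le_prod_tail {x : G} {l : List G} (h : IsGreedy Δ (x :: l)) : 1 ≤ l.prod := by
  have hx : x ≤ x * l.prod := by
    conv_lhs => rw [h.1]
    exact inf_le_left
  exact (le_mul_iff_one_le_right' x).1 hx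

theorem prod_take (hΔ : IsGarside Δ) {l : List G} (h : IsGreedy Δ l) (hl : 1 ≤ l.prod) (m : ℕ) :
    (l.take m).prod = l.prod ⊓ Δ ^ m := by
  induction l generalizing m with
  | nil => simpa using one_le_pow_of_one_le' hΔ.one_le m
  | cons x l ih =>
    cases m with
    | zero => simpa using hl
    | succ m =>
      -- Greediness of `x`, multiplied by `Δ ^ m`; the first term of the meet is then absorbed by `x
      -- * l.prod`.
      have hx : x * Δ ^ m = x * l.prod * Δ ^ m ⊓ Δ ^ (m + 1) := by
        rw [pow_succ', ← hΔ.inf_mul_pow, ← h.1]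
      rw [List.take_succ_cons, List.prod_cons, List.prod_cons, ih h.2 h.one_le_prod_tail, mul_inf,
        hx, ← inf_assoc,
        inf_eq_left.2 (le_mul_of_one_le_right' (one_le_pow_of_one_le' hΔ.one_le m))]

theorem prod_le_pow_length (hΔ : IsGarside Δ) {l : List G} (h : IsGreedy Δ l) (hl : 1 ≤ l.prod) :
    l.prod ≤ Δ ^ l.length := by
  rw [← inf_eq_left, ← h.prod_take hΔ hl, List.take_length]

theorem length_le_one (hΔ : IsGarside Δ) {l : List G} (h : IsGreedy Δ l) (hne : ∀ x ∈ l, x ≠ 1)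
    (hl : l.prod ≤ Δ) : l.length ≤ 1 := by
  match l, h with
  | [], _ => simp
  | [_], _ => simp
  | x :: y :: l, h =>
    exfalso
    have h1 : (y :: l).prod = 1 := by
      have := h.1
      rw [← List.prod_cons, inf_eq_left.2 hl, List.prod_cons] at this
      exact (mul_eq_left (a := x)).1 this.symm
    refine hne y (by simp) ?_
    rw [h.2.1, ← List.prod_cons, h1, inf_eq_left.2 hΔ.one_le]

theorem replicate_append (hΔ : IsGarside Δ) {l : List G} (h : IsGreedy Δ l) (hl : 1 ≤ l.prod)
    (n : ℕ) : IsGreedy Δ (List.replicate n Δ ++ l) := by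
  induction n with
  | zero => simpa using h
  | succ n ih =>
    refine ⟨?_, ih⟩
    rw [eq_comm, inf_eq_right]
    refine le_mul_of_one_le_right' ?_
    change 1 ≤ (List.replicate n Δ ++ l).prod
    rw [List.prod_append, List.prod_replicate]
    exact one_le_mul (one_le_pow_of_one_le' hΔ.one_le n) hl

theorem exists_prod_eq (hΔ : IsGarside Δ) (n : ℕ) {w : G} (hw : 1 ≤ w) (hwn : w ≤ Δ ^ n) :
    ∃ l : List G, l.prod = w ∧ IsGreedy Δ l ∧ ∀ x ∈ l, x ≠ 1 := by
  induction n generalizing w with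
  | zero => exact ⟨[], by simpa using le_antisymm hw (by simpa using hwn), trivial, by simp⟩
  | succ n ih =>
    by_cases h1 : w = 1
    · exact ⟨[], by simp [h1], trivial, by simp⟩
    -- Splitting off `w ⊓ Δ` leaves a remainder below `Δ ^ n`, so the induction applies.
    have hle : w ≤ (w ⊓ Δ) * Δ ^ n := by
      rw [hΔ.inf_mul_pow, ← pow_succ']
      exact le_inf (le_mul_of_one_le_right' (one_le_pow_of_one_le' hΔ.one_le n)) hwn
    obtain ⟨l, hl, hg, hne⟩ := ih (w := (w ⊓ Δ)⁻¹ * w)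
      (by rw [le_inv_mul_iff_mul_le, mul_one]; exact inf_le_left) (by rwa [inv_mul_le_iff_le_mul])
    refine ⟨(w ⊓ Δ) :: l, by simp [hl], ⟨by simp [hl], hg⟩, ?_⟩
    rintro x (_ | ⟨_, hx⟩)
    · intro hone
      exact h1 (le_antisymm (le_one_of_inf_eq_one hΔ hone hwn) hw)
    · exact hne x hx

end IsGreedy

/-! ### Normal forms, `inf`, `sup` and the initial factor -/

section NormalForm

variable [Nontrivial G]

theorem exists_isLeftNormalForm (hΔ : IsGarside Δ) (X : G) :
    ∃ q : ℤ × List G, IsLeftNormalForm Δ X q.1 q.2 := by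
  obtain ⟨n, hn, hn'⟩ := hΔ.exists_le_pow X
  obtain ⟨p, hp, hmax⟩ := Int.exists_greatest_of_bdd (P := fun k => Δ ^ k ≤ X)
    ⟨n, fun k hk => hΔ.zpow_le_zpow_iff.1 (hk.trans hn')⟩ ⟨-n, hn⟩
  obtain ⟨b, -, hb⟩ := hΔ.exists_le_pow (Δ ^ (-p) * X)
  obtain ⟨l, hl, hg, hne⟩ := IsGreedy.exists_prod_eq hΔ b (w := Δ ^ (-p) * X)
    (by rwa [zpow_neg, le_inv_mul_iff_mul_le, mul_one]) (by simpa using hb)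
  exact ⟨(p, l), by simp [hl], ⟨hp, hmax⟩, hne, isGreedy_iff.1 hg⟩

theorem isLeftNormalForm_leftNormalForm (hΔ : IsGarside Δ) (X : G) :
    IsLeftNormalForm Δ X (infimum Δ X) (leftNormalForm Δ X).2 := by
  have h := exists_isLeftNormalForm hΔ X
  rw [infimum, leftNormalForm, dif_pos h]
  exact h.choose_spec

theorem le_infimum_iff (hΔ : IsGarside Δ) {X : G} {k : ℤ} : k ≤ infimum Δ X ↔ Δ ^ k ≤ X := by
  have h := (isLeftNormalForm_leftNormalForm hΔ X).isGreatest
  exact ⟨fun hk => (hΔ.zpow_le_zpow hk).trans h.1, fun hk => h.2 hk⟩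

theorem infimum_mul_zpow (hΔ : IsGarside Δ) (X : G) (k : ℤ) :
    infimum Δ (X * Δ ^ k) = infimum Δ X + k := by
  refine eq_of_forall_le_iff fun j => ?_
  rw [← sub_le_iff_le_add, le_infimum_iff hΔ, le_infimum_iff hΔ,
    ← hΔ.mul_zpow_le_mul_zpow_iff k (b := X), ← zpow_add, sub_add_cancel]

theorem infimum_inf_pow (hΔ : IsGarside Δ) (X : G) (m : ℕ) :
    infimum Δ (X ⊓ Δ ^ m) = min (infimum Δ X) m := by
  refine eq_of_forall_le_iff fun j => ?_
  rw [le_min_iff, le_infimum_iff hΔ, le_infimum_iff hΔ, le_inf_iff, ← zpow_natCast,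
    hΔ.zpow_le_zpow_iff]

theorem one_le_prod_leftNormalForm (hΔ : IsGarside Δ) (X : G) :
    1 ≤ (leftNormalForm Δ X).2.prod := by
  have h := isLeftNormalForm_leftNormalForm hΔ X
  have h1 := h.isGreatest.1
  change Δ ^ infimum Δ X ≤ X at h1
  conv_rhs at h1 => rw [h.eq_mul_prod]
  exact (le_mul_iff_one_le_right' _).1 h1

/-- Conjugation by `Δ ^ p` fixes `Δ` and preserves meets, so the twist `τ^(-p)` in the definition
moves `Δ ^ p` to the right of `X`. -/
theorem initialFactor_eq (hΔ : IsGarside Δ) (X : G) :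
    initialFactor Δ X = X * Δ ^ (-infimum Δ X) ⊓ Δ := by
  have h := isLeftNormalForm_leftNormalForm hΔ X
  have heq := h.eq_mul_prod
  have hg := isGreedy_iff.2 h.factor
  rw [initialFactor]
  generalize infimum Δ X = p at heq ⊢
  generalize (leftNormalForm Δ X).2 = l at heq hg
  match l, hg with
  | [], _ => simpa [heq] using hΔ.one_le
  | x :: l, hg =>
    have hshift : (shift Δ ^ (-p)) x = Δ ^ p * x * Δ ^ (-p) := by
      simp [shift, ← map_zpow, MulAut.conj_apply]
    have hΔp : Δ ^ p * Δ * Δ ^ (-p) = Δ := by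
      rw [← zpow_add_one, ← zpow_add]
      simp
    simp only
    rw [hshift, heq]
    calc Δ ^ p * x * Δ ^ (-p) = Δ ^ p * (x * l.prod ⊓ Δ) * Δ ^ (-p) := by rw [← hg.1]
      _ = _ := by rw [mul_inf, hΔ.inf_mul_zpow, hΔp, List.prod_cons]

theorem firstFactorsProd_eq (hΔ : IsGarside Δ) {X : G} (hX : 0 ≤ infimum Δ X) (m : ℕ) :
    firstFactorsProd Δ X m = X ⊓ Δ ^ m := by
  have h := isLeftNormalForm_leftNormalForm hΔ X
  have hl := one_le_prod_leftNormalForm hΔ X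
  have hprod : (List.replicate (infimum Δ X).toNat Δ ++ (leftNormalForm Δ X).2).prod = X := by
    rw [List.prod_append, List.prod_replicate]
    conv_rhs => rw [h.eq_mul_prod]
    rw [← zpow_natCast, Int.toNat_of_nonneg hX]
  rw [firstFactorsProd, ((isGreedy_iff.2 h.factor).replicate_append hΔ hl _).prod_take hΔ, hprod]
  rw [hprod, ← zpow_zero Δ, ← le_infimum_iff hΔ]
  exact hX

theorem le_zpow_supremum (hΔ : IsGarside Δ) (X : G) : X ≤ Δ ^ supremum Δ X := by
  have h := isLeftNormalForm_leftNormalForm hΔ X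
  conv_lhs => rw [h.eq_mul_prod]
  rw [supremum, zpow_add, zpow_natCast]
  exact mul_le_mul_right ((isGreedy_iff.2 h.factor).prod_le_pow_length hΔ
    (one_le_prod_leftNormalForm hΔ X)) _

theorem canonicalLength_le_one (hΔ : IsGarside Δ) {X : G} (hX : X ≤ Δ ^ (infimum Δ X + 1)) :
    canonicalLength Δ X ≤ 1 := by
  have h := isLeftNormalForm_leftNormalForm hΔ X
  refine (isGreedy_iff.2 h.factor).length_le_one hΔ h.ne_one ?_
  conv_lhs at hX => rw [h.eq_mul_prod]
  rw [zpow_add_one] at hX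
  exact (mul_le_mul_iff_left _).1 hX

theorem infimum_le_infimum_cycling (hΔ : IsGarside Δ) (X : G) :
    infimum Δ X ≤ infimum Δ (cycling Δ X) := by
  set p := infimum Δ X with hp
  have h1 : 1 ≤ initialFactor Δ X := by
    rw [initialFactor_eq hΔ]
    refine le_inf ?_ hΔ.one_le
    rw [← hΔ.mul_zpow_le_mul_zpow_iff p, ← hp]
    simpa using (le_infimum_iff hΔ).1 hp.le
  have h2 : initialFactor Δ X * Δ ^ p ≤ X := by
    rw [← hΔ.mul_zpow_le_mul_zpow_iff (-p), initialFactor_eq hΔ, ← hp]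
    simp
  rw [le_infimum_iff hΔ, cycling, mul_assoc, le_inv_mul_iff_mul_le]
  exact h2.trans (le_mul_of_one_le_right' h1)

/-- Cycling never lowers `inf`, and a monotone periodic sequence is constant. -/
theorem infimum_iterate_cycling (hΔ : IsGarside Δ) {X : G} {t : ℕ} (ht : 0 < t)
    (hX : (cycling Δ)^[t] X = X) (i : ℕ) : infimum Δ ((cycling Δ)^[i] X) = infimum Δ X := by
  have mono : Monotone fun n : ℕ => infimum Δ ((cycling Δ)^[n] X) :=
    monotone_nat_of_le_succ fun n => by
      rw [Function.iterate_succ_apply']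
      exact infimum_le_infimum_cycling hΔ _
  refine le_antisymm ?_ (mono (Nat.zero_le i))
  refine (mono (Nat.le_mul_of_pos_left i ht)).trans_eq ?_
  simp only [Function.iterate_mul, Function.iterate_fixed hX]

end NormalForm

/-! ### Powers of a cycling-periodic element -/

section Cycling

/-- The map whose iterates at `1` are the products of conjugators of iterated cycling. -/
def headMap (Δ X : G) (p : ℤ) (s : G) : G := X * s * Δ ^ (-p) ⊓ s * Δ

theorem cyclingConjugatorProd_eq_iterate [Nontrivial G] (hΔ : IsGarside Δ) {X : G} {t : ℕ}
    (ht : 0 < t) (hX : (cycling Δ)^[t] X = X) (m : ℕ) :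
    cyclingConjugatorProd Δ X m = (headMap Δ X (infimum Δ X))^[m] 1 := by
  induction m with
  | zero => simp [cyclingConjugatorProd]
  | succ m ih =>
    rw [Function.iterate_succ_apply', ← ih, cyclingConjugatorProd_succ, headMap,
      initialFactor_eq hΔ, infimum_iterate_cycling hΔ ht hX, mul_cyclingConjugatorProd, mul_inf,
      mul_assoc]

theorem pow_mul_zpow_inf_pow_eq [Nontrivial G] (hΔ : IsGarside Δ) {X : G} {t : ℕ} (ht : 0 < t)
    (hX : (cycling Δ)^[t] X = X) (m : ℕ) :
    X ^ m * Δ ^ (-(m * infimum Δ X)) ⊓ Δ ^ m = cyclingConjugatorProd Δ X m := by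
  have hcomm : X * cyclingConjugatorProd Δ X t = cyclingConjugatorProd Δ X t * X := by
    rw [mul_cyclingConjugatorProd, hX]
  have hiter := cyclingConjugatorProd_eq_iterate hΔ ht hX
  have h := iterate_eq_iterate_inf_iterate (ψ := fun s => X * s * Δ ^ (-infimum Δ X))
    (δ := fun s => s * Δ) (F := headMap Δ X (infimum Δ X))
    (c := OrderIso.mulLeft (cyclingConjugatorProd Δ X t))
    (fun a b => by rw [mul_inf, hΔ.inf_mul_zpow]) (fun a b => hΔ.inf_mul a b) (fun s => rfl)
    (fun s => by
      change X * (s * Δ) * Δ ^ (-infimum Δ X) = X * s * Δ ^ (-infimum Δ X) * Δ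
      simp only [mul_assoc, mul_right_inj]
      exact ((Commute.refl Δ).zpow_right _).eq)
    (fun s => by
      simp only [OrderIso.mulLeft_apply, ← mul_assoc, hcomm])
    (fun s => by simp only [OrderIso.mulLeft_apply, mul_assoc])
    (a := 1) ht (by simp [hiter]) m
  rw [iterate_mul_mul_zpow, ← hiter, mul_one] at h
  rw [h, show (fun s : G => s * Δ) = (· * Δ) from rfl, mul_right_iterate]
  simp only [one_mul]

theorem cyclingConjugatorProd_le_pow [Nontrivial G] (hΔ : IsGarside Δ) {X : G} {t : ℕ}
    (ht : 0 < t) (hX : (cycling Δ)^[t] X = X) (m : ℕ) : cyclingConjugatorProd Δ X m ≤ Δ ^ m := by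
  rw [← pow_mul_zpow_inf_pow_eq hΔ ht hX]
  exact inf_le_right

theorem cyclingConjugatorProd_succ_eq_inf [Nontrivial G] (hΔ : IsGarside Δ) {X : G} {t : ℕ}
    (ht : 0 < t) (hX : (cycling Δ)^[t] X = X) (m : ℕ) : cyclingConjugatorProd Δ X (m + 1) =
      X * cyclingConjugatorProd Δ X m * Δ ^ (-infimum Δ X) ⊓ cyclingConjugatorProd Δ X m * Δ := by
  simp only [cyclingConjugatorProd_eq_iterate hΔ ht hX, Function.iterate_succ_apply', headMap]

theorem mul_infimum_le_infimum_pow [Nontrivial G] (hΔ : IsGarside Δ) (X : G) (m : ℕ) :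
    m * infimum Δ X ≤ infimum Δ (X ^ m) := by
  induction m with
  | zero => simp [le_infimum_iff hΔ]
  | succ m ih =>
    rw [le_infimum_iff hΔ] at ih ⊢
    rw [Nat.cast_succ, add_mul, one_mul, add_comm, zpow_add, pow_succ']
    exact ((hΔ.mul_zpow_le_mul_zpow_iff _).2 ((le_infimum_iff hΔ).1 le_rfl)).trans
      (mul_le_mul_right ih X)

/-- Otherwise `C_m = Δ^m`, whence `Δ^m ≤ X C_(m-1) Δ^(-p) ≤ X Δ^(m-1) Δ^(-p)`, an element with `inf`
equal to `m - 1`. -/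
theorem infimum_pow_mul_zpow_lt [Nontrivial G] (hΔ : IsGarside Δ) {X : G} {t : ℕ} (ht : 0 < t)
    (hX : (cycling Δ)^[t] X = X) {m : ℕ} (hm : 1 ≤ m) :
    infimum Δ (X ^ m * Δ ^ (-(m * infimum Δ X))) < m := by
  by_contra! h
  rw [le_infimum_iff hΔ, zpow_natCast] at h
  have hC := pow_mul_zpow_inf_pow_eq hΔ ht hX m
  obtain ⟨k, rfl⟩ := Nat.exists_eq_add_of_le' hm
  rw [inf_eq_right.2 h, cyclingConjugatorProd_succ_eq_inf hΔ ht hX] at hC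
  have h1 : Δ ^ (k + 1) ≤ X * Δ ^ k * Δ ^ (-infimum Δ X) :=
    (hC.le.trans inf_le_left).trans ((hΔ.mul_zpow_le_mul_zpow_iff _).2
      (mul_le_mul_right (cyclingConjugatorProd_le_pow hΔ ht hX k) X))
  rw [← zpow_natCast, ← zpow_natCast, ← le_infimum_iff hΔ, infimum_mul_zpow hΔ,
    infimum_mul_zpow hΔ] at h1
  push_cast at h1
  lia

/-- Otherwise `C_m = X^m Δ^(-mp)`; comparing with `C_m ≤ C_(m-1) Δ ≤ X^(m-1) Δ^(-(m-1)p) Δ` and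
cancelling `X^(m-1)` gives `X ≤ Δ^(p+1)`, so `ℓ(X) ≤ 1`. -/
theorem le_supremum_pow_mul_zpow [Nontrivial G] (hΔ : IsGarside Δ) {X : G} {t : ℕ} (ht : 0 < t)
    (hX : (cycling Δ)^[t] X = X) {m : ℕ} (hm : 1 ≤ m) (hl : 1 < canonicalLength Δ X) :
    m ≤ supremum Δ (X ^ m * Δ ^ (-(m * infimum Δ X))) := by
  by_contra! h
  refine hl.not_ge (canonicalLength_le_one hΔ ?_)
  have hC := pow_mul_zpow_inf_pow_eq hΔ ht hX m
  rw [inf_eq_left.2 ((le_zpow_supremum hΔ _).trans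
    ((hΔ.zpow_le_zpow h.le).trans_eq (zpow_natCast Δ m)))] at hC
  obtain ⟨k, rfl⟩ := Nat.exists_eq_add_of_le' hm
  have hk : cyclingConjugatorProd Δ X k ≤ X ^ k * Δ ^ (-(k * infimum Δ X)) := by
    rw [← pow_mul_zpow_inf_pow_eq hΔ ht hX]
    exact inf_le_left
  rw [cyclingConjugatorProd_succ_eq_inf hΔ ht hX] at hC
  have h1 := (hC.le.trans inf_le_right).trans (hΔ.mul_le_mul_right_iff.2 hk)
  rw [pow_succ, mul_assoc, mul_assoc, mul_le_mul_iff_left,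
    ← hΔ.mul_zpow_le_mul_zpow_iff ((k + 1 : ℕ) * infimum Δ X), mul_assoc, ← zpow_add,
    ← zpow_add_one, ← zpow_add, neg_add_cancel, zpow_zero, mul_one] at h1
  refine h1.trans_eq (congrArg _ ?_)
  push_cast
  ring

theorem initialFactor_pow [Nontrivial G] (hΔ : IsGarside Δ) {X : G} {t : ℕ} (ht : 0 < t)
    (hX : (cycling Δ)^[t] X = X) {m : ℕ} (hm : 1 ≤ m) :
    initialFactor Δ (X ^ m) = initialFactor Δ (cyclingConjugatorProd Δ X m) := by
  have hlt := infimum_pow_mul_zpow_lt hΔ ht hX hm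
  have hinf := infimum_mul_zpow hΔ (X ^ m) (-(m * infimum Δ X))
  -- The strict bound on `inf` makes this exponent at least 1, so truncating at `Δ ^ m` does not
  -- affect the initial factor.
  have hle : Δ ≤ Δ ^ ((m : ℤ) + -infimum Δ (X ^ m * Δ ^ (-(m * infimum Δ X)))) := by
    conv_lhs => rw [← zpow_one Δ]
    exact hΔ.zpow_le_zpow (by lia)
  rw [initialFactor_eq hΔ, initialFactor_eq hΔ, ← pow_mul_zpow_inf_pow_eq hΔ ht hX,
    infimum_inf_pow hΔ, min_eq_left hlt.le, hΔ.inf_mul_zpow, inf_assoc, mul_assoc, ← zpow_add,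
    ← zpow_natCast Δ m, ← zpow_add, inf_eq_right.2 hle, hinf]
  congr 3
  ring

theorem infimum_pow_eq [Nontrivial G] (hΔ : IsGarside Δ) {X : G} {t : ℕ} (ht : 0 < t)
    (hX : (cycling Δ)^[t] X = X) {m : ℕ} (hm : 1 ≤ m) :
    infimum Δ (X ^ m) = m * infimum Δ X + infimum Δ (cyclingConjugatorProd Δ X m) := by
  rw [← pow_mul_zpow_inf_pow_eq hΔ ht hX, infimum_inf_pow hΔ,
    min_eq_left (infimum_pow_mul_zpow_lt hΔ ht hX hm).le, infimum_mul_zpow hΔ]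
  ring

end Cycling

end GarsideGroup

open GarsideGroup in
theorem mainTheorem1 {G : Type*} [Group G] [Lattice G] [MulLeftMono G] (Δ : G)
    (hΔ : IsGarside Δ) (X : G) (hX : X ∈ ultraSummitSet Δ X) (m : ℕ) (hm : 1 ≤ m) :
    (1 < canonicalLength Δ X →
      (0 ≤ infimum Δ (X ^ m * Δ ^ (-((m : ℤ) * infimum Δ X))) ∧
        (m : ℤ) ≤ supremum Δ (X ^ m * Δ ^ (-((m : ℤ) * infimum Δ X))) ∧
        firstFactorsProd Δ (X ^ m * Δ ^ (-((m : ℤ) * infimum Δ X))) m =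
          cyclingConjugatorProd Δ X m) ∧
      (X ^ m * Δ ^ (-((m : ℤ) * infimum Δ X))) ⊓ Δ ^ m = cyclingConjugatorProd Δ X m ∧
      initialFactor Δ (X ^ m) = initialFactor Δ (cyclingConjugatorProd Δ X m)) ∧
    infimum Δ (X ^ m) =
      (m : ℤ) * infimum Δ X + infimum Δ (cyclingConjugatorProd Δ X m) := by
  rcases subsingleton_or_nontrivial G with _ | _
  · simp [canonicalLength, infimum, leftNormalForm_of_subsingleton]
  obtain ⟨-, t, ht, hc⟩ := hX
  have hinf : 0 ≤ infimum Δ (X ^ m * Δ ^ (-((m : ℤ) * infimum Δ X))) := by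
    have := mul_infimum_le_infimum_pow hΔ X m
    rw [infimum_mul_zpow hΔ]
    lia
  have heq := pow_mul_zpow_inf_pow_eq hΔ ht hc m
  exact ⟨fun hl => ⟨⟨hinf, le_supremum_pow_mul_zpow hΔ ht hc hm hl,
    (firstFactorsProd_eq hΔ hinf m).trans heq⟩, heq, initialFactor_pow hΔ ht hc hm⟩,
    infimum_pow_eq hΔ ht hc hm⟩
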